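/- Let $F$ be a field and let $A = F[h][X]/(X^2 - hX)$ be the Frobenius algebra over $F[h]$ with counit $\epsilon(1)=0$, $\epsilon(X)=1$, so that $\Delta(1) = 1\otimes X + X\otimes 1 - h(1\otimes 1)$ and $\Delta(X) = X\otimes X$. For an oriented link diagram $D$ let $C = \mathit{CKh}_h(D;F)$ be the Khovanov complex of $D$ built from $A$ (a complex of free $F[h]$-modules, whose summand at a vertex of the cube of resolutions is the tensor power of $A$ indexed by the circles of the resolution), and let $\mathit{Kh}_h(D;F)$ be its homology. Fix a base point on $D$. The reduced complex $\widetilde{C}$ is either one of the subcomplexes $C_X, C_Y \subset C$ spanned by the enhanced states whose circle through the base point is labelled $X$, respectively $Y = X - h$; its homology is denoted $\widetilde{\mathit{Kh}}_h(D;F)$. Let $\widehat{\sigma}$ be the involution of $C$ that is semilinear with respect to $h \mapsto -h$ and is given on each tensor power of $A$ by the tensor power of the map $1 \mapsto 1$, $X \mapsto X - h$. The map $\mathrm{id} - \widehat{\sigma}$ is divisible by $h$; put $\widehat{\nu} = (\mathrm{id} - \widehat{\sigma})/h$. Write $\mathrm{Tor}$ for the $F[h]$-torsion submodule. Proposition.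 Let $D$ be an $\ell$-component pointed link diagram whose reduced homology $\widetilde{\mathit{Kh}}_h(D;F)$ has rank at most $1$ over $F[h]$ in each homological grading. Let $z_1, \dots, z_{2^{\ell-1}} \in \widetilde{C}$ be $2^{\ell-1}$ cycles whose classes form an $F[h]$-basis of $\widetilde{\mathit{Kh}}_h(D;F)/\mathrm{Tor} \cong F[h]^{2^{\ell-1}}$. Then $z_1, \widehat{\nu}(z_1), \dots, z_{2^{\ell-1}}, \widehat{\nu}(z_{2^{\ell-1}})$ are $2^{\ell}$ cycles in $C$ whose classes form an $F[h]$-basis of $\mathit{Kh}_h(D;F)/\mathrm{Tor} \cong F[h]^{2^{\ell}}$. -/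

import Mathlib

open Polynomial

namespace Khovanov

/-- An oriented link diagram, encoded as an oriented planar diagram code.

There are `n` crossings and `k` further circles without crossings. The four half-edges at a
crossing `c` are `(c, 0), (c, 1), (c, 2), (c, 3)` in counterclockwise order, where `(c, 0)` and
`(c, 2)` belong to the under-strand and `(c, 1)` and `(c, 3)` to the over-strand. The involution
`glue` joins the half-edges to form the edges. `out x` says that the half-edge `x` is oriented
away from its crossing. The last field is Euler's formula `V + F = E + 2 K` for the underlying
4-valent graph with its cyclic orders at the vertices: every connected component of this graph is
drawn on a sphere. -/
structure LinkDiagram where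
  n : ℕ
  k : ℕ
  glue : Fin n × ZMod 4 → Fin n × ZMod 4
  glue_glue : ∀ x, glue (glue x) = x
  out : Fin n × ZMod 4 → Bool
  out_glue : ∀ x, out (glue x) = !out x
  out_opposite : ∀ c i, out (c, i + 2) = !out (c, i)
  planar :
    n + Nat.card (Quot fun x y : Fin n × ZMod 4 => y = ((glue x).1, (glue x).2 + 1)) =
      2 * n + 2 * Nat.card (Quot fun x y : Fin n × ZMod 4 => y = glue x ∨ y = (x.1, x.2 + 1))

namespace LinkDiagram

variable (D : LinkDiagram)

/-- Half-edges at crossings. -/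
abbrev HalfEdge : Type := Fin D.n × ZMod 4

/-- Possible positions of a base point: on the edge of a half-edge, or on a crossingless circle. -/
abbrev Point : Type := D.HalfEdge ⊕ Fin D.k

/-- The number of components of the link: a strand goes straight through every crossing. -/
noncomputable def numComponents : ℕ :=
  Nat.card ((Quot fun x y : D.HalfEdge => y = D.glue x ∨ y = (x.1, x.2 + 2)) ⊕ Fin D.k)

/-- The number of negative crossings. The crossing `c` is positive if and only if exactly one of
the half-edges `(c, 0)` and `(c, 1)` is oriented outwards. -/
def numNegative : ℕ := (Finset.univ.filter fun c => D.out (c, 0) = D.out (c, 1)).card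

/-- A vertex of the cube of resolutions: `false` stands for the 0-smoothing of a crossing and
`true` for its 1-smoothing. -/
abbrev Vertex : Type := Fin D.n → Bool

/-- The 0-smoothing connects the half-edges at a crossing as `0 - 1`, `2 - 3`, the 1-smoothing
connects them as `0 - 3`, `1 - 2`. -/
def smooth (v : D.Vertex) (x : D.HalfEdge) : D.HalfEdge :=
  (x.1, if v x.1 = true then 3 - x.2 else 1 - x.2)

/-- The circles of the resolution of the diagram at a vertex. -/
abbrev Circle (v : D.Vertex) : Type :=
  (Quot fun x y : D.HalfEdge => y = D.glue x ∨ y = D.smooth v x) ⊕ Fin D.k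

/-- The circle on which a point lies. -/
def circleOf (v : D.Vertex) (p : D.Point) : D.Circle v := Sum.map (Quot.mk _) id p

/-- Enhanced states: a vertex of the cube, and a label on every circle of the resolution. The label
`false` stands for the generator `1` and `true` for the generator `X` of the Frobenius algebra
`A = F[h][X] / (X² - h X)`, so that the labels at `v` form the standard basis of the tensor power
of `A` over `F[h]` indexed by the circles at `v`. -/
abbrev EnhancedState : Type := Σ v : D.Vertex, (D.Circle v → Bool)

noncomputable instance (v : D.Vertex) : Fintype (D.Circle v) := Fintype.ofFinite _

noncomputable instance (v : D.Vertex) : DecidableEq (D.Circle v) := Classical.decEq _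

variable {D}

/-- The label of the circle through the point `p`. -/
def EnhancedState.label (S : D.EnhancedState) (p : D.Point) : Bool := S.2 (D.circleOf S.1 p)

/-- Change the label of the circle through `p` to `1`. -/
noncomputable def EnhancedState.relabelOne (S : D.EnhancedState) (p : D.Point) :
    D.EnhancedState :=
  ⟨S.1, Function.update S.2 (D.circleOf S.1 p) false⟩

variable (D)

/-- The homological grading: the number of 1-smoothings minus the number of negative crossings. -/
def degree (S : D.EnhancedState) : ℤ :=
  ((Finset.univ.filter fun c => S.1 c = true).card : ℤ) - D.numNegative

variable (F : Type*) [Field F]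

/-- The Khovanov complex of the diagram for the Frobenius algebra `A = F[h][X] / (X² - h X)` over
`F[h]`: the free module on the enhanced states. The variable of `F[X]` is the parameter `h`. -/
abbrev Chain : Type _ := D.EnhancedState → F[X]

variable {F}

/-- The coefficient of `c` in the product `a * b` in `A`, for generators `a`, `b`, `c`:
`1 * 1 = 1`, `1 * X = X * 1 = X`, `X * X = h X`. -/
noncomputable def mulCoeff : Bool → Bool → Bool → F[X]
  | false, false, false => 1
  | false, true, true => 1
  | true, false, true => 1
  | true, true, true => X
  | _, _, _ => 0

/-- The coefficient of `b ⊗ c` in the coproduct of `a`, for generators `a`, `b`, `c`: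
`Δ(1) = 1 ⊗ X + X ⊗ 1 - h (1 ⊗ 1)`, `Δ(X) = X ⊗ X`. -/
noncomputable def comulCoeff : Bool → Bool → Bool → F[X]
  | false, false, true => 1
  | false, true, false => 1
  | false, false, false => -X
  | true, true, true => 1
  | _, _, _ => 0

open Classical in
/-- The coefficient of `T` in the image of `S` under the (unsigned) edge map at the crossing `c`,
which is taken from the 0-smoothing to the 1-smoothing. If two circles are merged it is the
multiplication, if a circle is split it is the comultiplication, and the labels of all circles that
do not pass through `c` are kept. (By planarity, exactly one of the two happens.) -/
noncomputable def edgeCoeff (c : Fin D.n) (S T : D.EnhancedState) : F[X] :=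
  if S.1 c = false ∧ T.1 = Function.update S.1 c true ∧
      ∀ p : D.Point, D.circleOf S.1 p ≠ D.circleOf S.1 (Sum.inl (c, 0)) →
        D.circleOf S.1 p ≠ D.circleOf S.1 (Sum.inl (c, 2)) → S.label p = T.label p then
    if D.circleOf S.1 (Sum.inl (c, 0)) ≠ D.circleOf S.1 (Sum.inl (c, 2)) then
      mulCoeff (S.label (Sum.inl (c, 0))) (S.label (Sum.inl (c, 2))) (T.label (Sum.inl (c, 0)))
    else if D.circleOf T.1 (Sum.inl (c, 0)) ≠ D.circleOf T.1 (Sum.inl (c, 2)) then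
      comulCoeff (S.label (Sum.inl (c, 0))) (T.label (Sum.inl (c, 0))) (T.label (Sum.inl (c, 2)))
    else 0
  else 0

variable (F)

/-- The differential of the Khovanov complex, with the standard signs of the cube. -/
noncomputable def d : D.Chain F →ₗ[F[X]] D.Chain F :=
  Matrix.mulVecLin (Matrix.of fun T S : D.EnhancedState =>
    ∑ c : Fin D.n,
      (-1) ^ (Finset.univ.filter fun j => j < c ∧ S.1 j = true).card * D.edgeCoeff c S T)

/-- The part of homological grading `i`. -/
def gradedPart (i : ℤ) : Submodule F[X] (D.Chain F) where
  carrier := {x | ∀ S, D.degree S ≠ i → x S = 0}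
  add_mem' := by
    intro x y hx hy S hS
    simp [hx S hS, hy S hS]
  zero_mem' := by
    intro S _
    rfl
  smul_mem' := by
    intro r x hx S hS
    simp [hx S hS]

/-- The subcomplex `C_X` generated by the enhanced states for which the circle through the base
point is labelled `X`. -/
noncomputable def chainX (p : D.Point) : Submodule F[X] (D.Chain F) :=
  Submodule.span F[X]
    {x | ∃ S : D.EnhancedState, S.label p = true ∧ x = Pi.single S 1}

/-- The subcomplex `C_Y` generated by the enhanced states for which the circle through the base
point is labelled `Y = X - h`. -/
noncomputable def chainY (p : D.Point) : Submodule F[X] (D.Chain F) :=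
  Submodule.span F[X]
    {x | ∃ S : D.EnhancedState, S.label p = true ∧
      x = Pi.single S 1 - (X : F[X]) • Pi.single (S.relabelOne p) 1}

variable {F}

/-- The cycles of a subcomplex `C'`. -/
noncomputable def cycles (C' : Submodule F[X] (D.Chain F)) : Submodule F[X] (D.Chain F) :=
  C' ⊓ LinearMap.ker (D.d F)

/-- The homology of a subcomplex `C'` (over all homological gradings): cycles modulo boundaries.
The unreduced homology is the case `C' = ⊤`. -/
abbrev Homology (C' : Submodule F[X] (D.Chain F)) : Type _ :=
  D.cycles C' ⧸ (C'.map (D.d F)).submoduleOf (D.cycles C')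

/-- The homology of a subcomplex `C'` in homological grading `i`. -/
abbrev HomologyAt (C' : Submodule F[X] (D.Chain F)) (i : ℤ) : Type _ :=
  D.cycles (C' ⊓ D.gradedPart F i) ⧸
    ((C' ⊓ D.gradedPart F (i - 1)).map (D.d F)).submoduleOf (D.cycles (C' ⊓ D.gradedPart F i))

/-- The homology of a subcomplex modulo its `F[h]`-torsion. -/
abbrev HomologyModTor (C' : Submodule F[X] (D.Chain F)) : Type _ :=
  D.Homology C' ⧸ Submodule.torsion F[X] (D.Homology C')

/-- The class of a cycle in the homology modulo torsion. -/
noncomputable def homologyClass (C' : Submodule F[X] (D.Chain F)) (z : D.Chain F)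
    (hz : z ∈ D.cycles C') : D.HomologyModTor C' :=
  Submodule.Quotient.mk (Submodule.Quotient.mk ⟨z, hz⟩)

/-- The coefficient of `b` in the image of `a` under the graded involution of `A`, for generators
`a`, `b`: the involution is semilinear for `h ↦ -h`, fixes `1`, and sends `X` to `X - h`. -/
noncomputable def sigmaCoeff : Bool → Bool → F[X]
  | false, false => 1
  | false, true => 0
  | true, false => -X
  | true, true => 1

/-- The graded involution `σ̂` on the Khovanov complex: on the summand of every vertex it is the
tensor power of the graded involution of `A`. -/
noncomputable def sigmaHat (x : D.Chain F) : D.Chain F := fun T =>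
  ∑ s : D.Circle T.1 → Bool,
    (x ⟨T.1, s⟩).comp (-X) * ∏ q : D.Circle T.1, sigmaCoeff (s q) (T.2 q)

/-- The signed Shumakovitch operation `ν̂ = (id - σ̂) / h`. Every coefficient of `x - σ̂ x` is
divisible by `h`, see `X_smul_nuHat`. -/
noncomputable def nuHat (x : D.Chain F) : D.Chain F := fun T => ((x - D.sigmaHat x) T).divX

theorem X_smul_nuHat (x : D.Chain F) : (X : F[X]) • D.nuHat x = x - D.sigmaHat x := by
  funext T
  have key : ((x - D.sigmaHat x) T).coeff 0 = 0 := by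
    have h1 : ∀ a b : Bool, (sigmaCoeff a b : F[X]).eval 0 = if a = b then 1 else 0 := by
      intro a b
      cases a <;> cases b <;> simp [sigmaCoeff]
    rw [Polynomial.coeff_zero_eq_eval_zero]
    simp only [Pi.sub_apply, sigmaHat, eval_sub, eval_finsetSum, eval_mul, eval_prod, h1,
      eval_comp, eval_neg, eval_X, neg_zero]
    rw [Finset.sum_eq_single T.2]
    · simp
    · intro s _ hs
      obtain ⟨q, hq⟩ := Function.ne_iff.mp hs
      rw [Finset.prod_eq_zero (Finset.mem_univ q) (by simp [hq]), mul_zero]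
    · simp
  have h2 := Polynomial.X_mul_divX_add ((x - D.sigmaHat x) T)
  rw [key, C_0, add_zero] at h2
  simpa [nuHat] using h2

end LinkDiagram

end Khovanov

/-! Write `C'` for the chosen reduced complex and `C''` for the other one. Since `σ̂` sends `X` to
`Y = X - h` and `Y` to `X`, it exchanges the two. They meet only in zero, and `h • 1 = X - Y` puts
`h C` inside `C' + C''`.

From this, every chain is `ν̂ w + u` for unique `w, u ∈ C'`. If `hx = u + y` with `u ∈ C'` and `y ∈
C''`, then `w = -σ̂ y` works, because `h (x - ν̂ w) = u + σ̂ y` lies in `C'` and `C'` is saturated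
with respect to `h` (`IsSigmaPair.exists_nuHat_add`). If `w` and `ν̂ w` both lie in `C'`, then so
does `σ̂ w = w - h ν̂ w`, which also lies in `C''` and hence vanishes
(`IsSigmaPair.eq_zero_of_nuHat_mem`). As `ν̂` commutes with `d` and `C'` is a subcomplex, cycles and
boundaries split in the same way: additively, homology is two copies of reduced homology.

The splitting is not `F[h]`-linear. However, `ν̂ (f x) = f(-h) ν̂ x + g x` with `g = (f - f(-h)) /
h`, so `ν̂` is semilinear modulo `C'`, and `f ↦ f(-h)` is bijective. This triangular behaviour is
enough to carry a basis modulo torsion upstairs. Torsion is respected because the even polynomial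
`f(-h) f` commutes with `ν̂`.

The geometric input is that `σ̂` commutes with `d` (`sigmaHat_d`). An edge map alters only the
tensor factors at one crossing, where it is the product or coproduct of `A`, and both are compatible
with the involution of `A`. -/

namespace Khovanov

namespace LinkDiagram

/-! ### Circles of a resolution and how they change at one crossing -/

section Circles

variable (D : LinkDiagram)

/-- The induction principle for circles. Statements about two points of one circle are proved below
by choosing a suitable invariant `f`. -/
theorem eq_of_circleOf_eq {β : Type*} (v : D.Vertex) (f : D.Point → β)
    (hglue : ∀ x, f (Sum.inl (D.glue x)) = f (Sum.inl x))
    (hsmooth : ∀ x, f (Sum.inl (D.smooth v x)) = f (Sum.inl x)) {p q : D.Point}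
    (h : D.circleOf v p = D.circleOf v q) : f p = f q := by
  let g : D.Circle v → β := Sum.elim
    (Quot.lift (fun x => f (Sum.inl x)) (by
      rintro x y (rfl | rfl)
      · exact (hglue x).symm
      · exact (hsmooth x).symm))
    (fun i => f (Sum.inr i))
  have hg : ∀ r, g (D.circleOf v r) = f r := by
    rintro (x | i) <;> rfl
  rw [← hg p, ← hg q, h]

theorem circleOf_surjective (v : D.Vertex) : Function.Surjective (D.circleOf v) := by
  rintro (x | i)
  · obtain ⟨x, rfl⟩ := Quot.exists_rep x
    exact ⟨Sum.inl x, rfl⟩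
  · exact ⟨Sum.inr i, rfl⟩

theorem circleOf_glue (v : D.Vertex) (x : D.HalfEdge) :
    D.circleOf v (Sum.inl (D.glue x)) = D.circleOf v (Sum.inl x) :=
  congrArg Sum.inl (Quot.sound (r := fun x y => y = D.glue x ∨ y = D.smooth v x) (Or.inl rfl)).symm

theorem circleOf_smooth (v : D.Vertex) (x : D.HalfEdge) :
    D.circleOf v (Sum.inl (D.smooth v x)) = D.circleOf v (Sum.inl x) :=
  congrArg Sum.inl (Quot.sound (r := fun x y => y = D.glue x ∨ y = D.smooth v x) (Or.inr rfl)).symm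

theorem smooth_smooth (v : D.Vertex) (x : D.HalfEdge) : D.smooth v (D.smooth v x) = x := by
  obtain ⟨c, i⟩ := x
  simp only [smooth]
  split_ifs <;> simp

theorem smooth_ne (v : D.Vertex) (x : D.HalfEdge) : D.smooth v x ≠ x := by
  obtain ⟨c, i⟩ := x
  simp only [smooth, ne_eq, Prod.mk.injEq, true_and]
  split_ifs
  · revert i; decide
  · revert i; decide

theorem glue_ne (x : D.HalfEdge) : D.glue x ≠ x := by
  intro h
  have := D.out_glue x
  rw [h] at this
  cases hx : D.out x <;> simp [hx] at this

theorem smooth_eq_smooth {v w : D.Vertex} {x : D.HalfEdge} (h : v x.1 = w x.1) :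
    D.smooth v x = D.smooth w x := by
  simp [smooth, h]

/-- The circle at `v` through the point `p` passes through the crossing `c`. -/
def Through (v : D.Vertex) (c : Fin D.n) (p : D.Point) : Prop :=
  D.circleOf v p = D.circleOf v (Sum.inl (c, 0)) ∨ D.circleOf v p = D.circleOf v (Sum.inl (c, 2))

variable {D}

theorem circleOf_one {v : D.Vertex} {c : Fin D.n} (h : v c = false) :
    D.circleOf v (Sum.inl (c, 1)) = D.circleOf v (Sum.inl (c, 0)) := by
  simpa [smooth, h] using D.circleOf_smooth v (c, 0)

theorem circleOf_three {v : D.Vertex} {c : Fin D.n} (h : v c = true) :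
    D.circleOf v (Sum.inl (c, 3)) = D.circleOf v (Sum.inl (c, 0)) := by
  simpa [smooth, h] using D.circleOf_smooth v (c, 0)

theorem circleOf_three' {v : D.Vertex} {c : Fin D.n} (h : v c = false) :
    D.circleOf v (Sum.inl (c, 3)) = D.circleOf v (Sum.inl (c, 2)) := by
  have := D.circleOf_smooth v (c, 2)
  simp only [smooth, h] at this
  exact this

theorem circleOf_one' {v : D.Vertex} {c : Fin D.n} (h : v c = true) :
    D.circleOf v (Sum.inl (c, 1)) = D.circleOf v (Sum.inl (c, 2)) := by
  have := D.circleOf_smooth v (c, 2)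
  simp only [smooth, h] at this
  exact this

theorem zmod_four_cases (i : ZMod 4) : i = 0 ∨ i = 1 ∨ i = 2 ∨ i = 3 := by
  revert i; decide

theorem through_self (v : D.Vertex) (c : Fin D.n) (i : ZMod 4) :
    D.Through v c (Sum.inl (c, i)) := by
  rcases zmod_four_cases i with rfl | rfl | rfl | rfl
  · exact Or.inl rfl
  · cases h : v c
    · exact Or.inl (circleOf_one h)
    · exact Or.inr (circleOf_one' h)
  · exact Or.inr rfl
  · cases h : v c
    · exact Or.inr (circleOf_three' h)
    · exact Or.inl (circleOf_three h)

theorem Through.of_circleOf_eq {v : D.Vertex} {c : Fin D.n} {p q : D.Point}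
    (hp : D.Through v c p) (h : D.circleOf v p = D.circleOf v q) : D.Through v c q := by
  unfold Through at *
  rwa [← h]

/-- The union of the circles meeting `c` does not depend on the smoothing at `c`. Indeed `Through w
c` is constant along circles at `v`: away from `c` the smoothings agree, and at `c` it always holds.
-/
theorem Through.change {v w : D.Vertex} {c : Fin D.n} (h : ∀ j, j ≠ c → v j = w j)
    {p : D.Point} (hp : D.Through v c p) : D.Through w c p := by
  have key : ∀ q : D.Point, D.circleOf v p = D.circleOf v q →
      D.Through w c p = D.Through w c q := by
    intro q hq
    refine D.eq_of_circleOf_eq v (D.Through w c) (fun x => ?_) (fun x => ?_) hq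
    · simp only [Through, circleOf_glue]
    · by_cases hx : x.1 = c
      · obtain ⟨c', i⟩ := x
        obtain rfl : c' = c := hx
        exact propext ⟨fun _ => through_self _ _ _, fun _ => through_self _ _ _⟩
      · rw [D.smooth_eq_smooth (h _ hx)]
        simp only [Through, circleOf_smooth]
  rcases hp with hp | hp
  · rw [key _ hp]; exact through_self _ _ _
  · rw [key _ hp]; exact through_self _ _ _

/-- Circles that avoid `c` survive unchanged. The invariant records the circle at `w`, collapsing
all points on circles through `c` to `none`. -/
theorem circleOf_eq_change {v w : D.Vertex} {c : Fin D.n} (h : ∀ j, j ≠ c → v j = w j)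
    {p q : D.Point} (hp : ¬ D.Through v c p) (hpq : D.circleOf v p = D.circleOf v q) :
    D.circleOf w p = D.circleOf w q := by
  classical
  have hq : ¬ D.Through v c q := fun hq => hp (hq.of_circleOf_eq hpq.symm)
  have key := D.eq_of_circleOf_eq v
    (fun r => if D.Through v c r then none else some (D.circleOf w r)) (fun x => ?_)
    (fun x => ?_) hpq
  · simpa [hp, hq] using key
  · have h1 : D.Through v c (Sum.inl (D.glue x)) = D.Through v c (Sum.inl x) := by
      simp only [Through, circleOf_glue]
    simp only [h1, circleOf_glue]
  · by_cases hx : x.1 = c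
    · obtain ⟨c', i⟩ := x
      obtain rfl : c' = c := hx
      have h1 : D.Through v c' (Sum.inl (D.smooth v (c', i))) := through_self _ _ _
      have h2 : D.Through v c' (Sum.inl (c', i)) := through_self _ _ _
      simp only [h1, h2, if_true]
    · have h1 : D.Through v c (Sum.inl (D.smooth v x)) = D.Through v c (Sum.inl x) := by
        simp only [Through, circleOf_smooth]
      have h2 : D.circleOf w (Sum.inl (D.smooth v x)) = D.circleOf w (Sum.inl x) := by
        rw [D.smooth_eq_smooth (h _ hx), circleOf_smooth]
      simp only [h1, h2]

theorem even_card_of_involution {α : Type*} (s : Finset α) (f : α → α)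
    (hmem : ∀ x ∈ s, f x ∈ s) (hf : ∀ x, f (f x) = x) (hne : ∀ x, f x ≠ x) : Even s.card := by
  have h : ∑ x ∈ s, (1 : ZMod 2) = 0 :=
    Finset.sum_involution (fun x _ => f x) (fun _ _ => by decide) (fun x _ _ => hne x)
      (fun x hx => hmem x hx) (fun x _ => hf x)
  rw [Finset.sum_const, nsmul_eq_mul, mul_one] at h
  exact (ZMod.natCast_eq_zero_iff_even).mp h

/-- If two different circles meet at a crossing, they are merged when the smoothing changes. -/
theorem circleOf_merge {v w : D.Vertex} {c : Fin D.n} (h : ∀ j, j ≠ c → v j = w j)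
    (hv : v c = false) (hw : w c = true)
    (hne : D.circleOf v (Sum.inl (c, 0)) ≠ D.circleOf v (Sum.inl (c, 2))) :
    D.circleOf w (Sum.inl (c, 0)) = D.circleOf w (Sum.inl (c, 2)) := by
  classical
  by_contra hcon
  rw [← circleOf_one' hw] at hcon
  -- Parity argument on the half-edges common to the circles through `(c, 0)` at `v` and at `w`.
  -- Gluing pairs them off. If the circles at `w` were also distinct, `(c, 0)` would be the only
  -- member at `c`, and smoothing would pair off all the others.
  let s : Finset D.HalfEdge := Finset.univ.filter fun x =>
    D.circleOf v (Sum.inl x) = D.circleOf v (Sum.inl (c, 0)) ∧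
      D.circleOf w (Sum.inl x) = D.circleOf w (Sum.inl (c, 0))
  have hs : ∀ x, x ∈ s ↔ D.circleOf v (Sum.inl x) = D.circleOf v (Sum.inl (c, 0)) ∧
      D.circleOf w (Sum.inl x) = D.circleOf w (Sum.inl (c, 0)) := fun x => by simp [s]
  have h0 : ((c, 0) : D.HalfEdge) ∈ s := (hs _).2 ⟨rfl, rfl⟩
  have e1 : Even s.card := even_card_of_involution s D.glue
    (fun x hx => by rw [hs] at hx ⊢; simpa only [circleOf_glue] using hx) D.glue_glue D.glue_ne
  have e2 : Even (s.erase (c, 0)).card := by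
    refine even_card_of_involution _ (D.smooth v) (fun x hx => ?_) (D.smooth_smooth v)
      (D.smooth_ne v)
    rw [Finset.mem_erase, hs] at hx
    obtain ⟨hx0, hxv, hxw⟩ := hx
    have hxc : x.1 ≠ c := by
      obtain ⟨c', i⟩ := x
      rintro rfl
      rcases zmod_four_cases i with rfl | rfl | rfl | rfl
      · exact hx0 rfl
      · exact hcon hxw.symm
      · exact hne hxv.symm
      · exact hne (hxv.symm.trans (circleOf_three' hv))
    rw [Finset.mem_erase, hs]
    refine ⟨fun hx => hxc (congrArg Prod.fst hx), ?_, ?_⟩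
    · rwa [circleOf_smooth]
    · rwa [D.smooth_eq_smooth (h _ hxc), circleOf_smooth]
  rw [Finset.card_erase_of_mem h0] at e2
  have := Finset.card_pos.mpr ⟨_, h0⟩
  grind

end Circles

/-! ### Compatibility of the edge maps with the involution, in matrix form -/

section Intertwining

variable {F : Type*} [Field F]

/-- The matrix entry of the tensor power of the involution of `A`. -/
noncomputable def sigmaProd {V : Type*} [Fintype V] (s t : V → Bool) : F[X] :=
  ∏ q, sigmaCoeff (s q) (t q)

theorem sigmaProd_equiv {V I R : Type*} [Fintype V] [Fintype I] [Fintype R] (e : I ⊕ R ≃ V)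
    (s t : V → Bool) : (sigmaProd s t : F[X]) =
      sigmaProd (fun i => s (e (Sum.inl i))) (fun i => t (e (Sum.inl i))) *
        sigmaProd (fun r => s (e (Sum.inr r))) (fun r => t (e (Sum.inr r))) := by
  unfold sigmaProd
  rw [← e.prod_comp, Fintype.prod_sum_type]

theorem sum_labels_equiv {V I R M : Type*} [Fintype V] [Fintype I] [Fintype R] [DecidableEq V]
    [DecidableEq I] [DecidableEq R] [AddCommMonoid M] (e : I ⊕ R ≃ V)
    (f : (I → Bool) → (R → Bool) → M) :
    ∑ s : V → Bool, f (fun i => s (e (Sum.inl i))) (fun r => s (e (Sum.inr r))) =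
      ∑ a, ∑ b, f a b := by
  rw [← Fintype.sum_prod_type']
  exact Fintype.sum_equiv
    ((e.symm.arrowCongr (Equiv.refl Bool)).trans (Equiv.sumArrowEquivProdArrow I R Bool)) _ _
    (fun s => rfl)

/-- A matrix between tensor powers that is the identity on all but a few factors commutes with the
involution if the matrix on these factors does. -/
theorem sum_mul_sigmaProd_of_local {I J R V W : Type*} [Fintype I] [Fintype J] [Fintype R]
    [Fintype V] [Fintype W] [DecidableEq I] [DecidableEq J] [DecidableEq R] [DecidableEq V]
    [DecidableEq W] (e : I ⊕ R ≃ V) (e' : J ⊕ R ≃ W) (M : (I → Bool) → (J → Bool) → F[X])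
    (E : (V → Bool) → (W → Bool) → F[X])
    (hE : ∀ s t, E s t = if (fun r => s (e (Sum.inr r))) = (fun r => t (e' (Sum.inr r))) then
      M (fun i => s (e (Sum.inl i))) (fun j => t (e' (Sum.inl j))) else 0)
    (hM : ∀ a b, ∑ b', (M a b').comp (-X) * sigmaProd b' b = ∑ a', sigmaProd a a' * M a' b)
    (s : V → Bool) (t : W → Bool) :
    ∑ t', (E s t').comp (-X) * sigmaProd t' t = ∑ s', sigmaProd s s' * E s' t := by
  simp only [hE, sigmaProd_equiv e, sigmaProd_equiv e']
  rw [sum_labels_equiv e' (fun b' r' =>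
      (if (fun r => s (e (Sum.inr r))) = r' then M (fun i => s (e (Sum.inl i))) b' else 0).comp (-X)
        * (sigmaProd b' (fun j => t (e' (Sum.inl j))) *
          sigmaProd r' (fun r => t (e' (Sum.inr r))))),
    sum_labels_equiv e (fun a' r' => sigmaProd (fun i => s (e (Sum.inl i))) a' *
      sigmaProd (fun r => s (e (Sum.inr r))) r' *
      (if r' = (fun r => t (e' (Sum.inr r))) then M a' (fun j => t (e' (Sum.inl j))) else 0))]
  -- The identity matrix on the `R`-factors collapses both sums over labels of `R`, leaving the same
  -- factor `sigmaProd` on each side.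
  simp only [apply_ite (fun f : F[X] => f.comp (-X)), zero_comp, ite_mul, zero_mul, mul_ite,
    mul_zero, Finset.sum_ite_eq, Finset.sum_ite_eq', Finset.mem_univ, if_true]
  simp only [← mul_assoc, mul_right_comm _ (sigmaProd (fun r => s (e (Sum.inr r))) _) (M _ _)]
  rw [← Finset.sum_mul, ← Finset.sum_mul, hM]

theorem sum_bool_labels {M : Type*} [AddCommMonoid M] (f : (Bool → Bool) → M) :
    ∑ a, f a = ∑ x, ∑ y, f (fun b => bif b then y else x) := by
  rw [← Fintype.sum_prod_type']
  refine Fintype.sum_equiv (Equiv.boolArrowEquivProd Bool) _ _ (fun s => ?_)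
  congr 1
  funext b
  cases b <;> rfl

theorem sum_unit_labels {M : Type*} [AddCommMonoid M] (f : (Unit → Bool) → M) :
    ∑ a, f a = ∑ x, f (fun _ => x) :=
  Fintype.sum_equiv (Equiv.funUnique Unit Bool) _ _ (fun _ => rfl)

/-- The involution is a semilinear ring map because `(X - h)² = -h (X - h)`. -/
theorem mulCoeff_intertwines (a : Bool → Bool) (b : Unit → Bool) :
    ∑ b' : Unit → Bool, (mulCoeff (a false) (a true) (b' ()) : F[X]).comp (-X) * sigmaProd b' b =
      ∑ a', sigmaProd a a' * mulCoeff (a' false) (a' true) (b ()) := by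
  rw [sum_unit_labels, sum_bool_labels]
  simp only [sigmaProd, Fintype.univ_bool, Finset.sum_insert, Finset.mem_singleton,
    Bool.true_eq_false, not_false_eq_true, Finset.sum_singleton, Finset.prod_insert,
    Finset.prod_singleton, Finset.univ_unique, cond_true, cond_false]
  generalize a false = x
  generalize a true = y
  generalize b default = z
  cases x <;> cases y <;> cases z <;> simp [mulCoeff, sigmaCoeff]

/-- Compatibility with the coproduct: `Δ(X - h) = (X - h) ⊗ (X - h)`, and `Δ(1)` is fixed by the
involution. -/
theorem comulCoeff_intertwines (a : Unit → Bool) (b : Bool → Bool) :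
    ∑ b' : Bool → Bool, (comulCoeff (a ()) (b' false) (b' true) : F[X]).comp (-X) * sigmaProd b' b =
      ∑ a', sigmaProd a a' * comulCoeff (a' ()) (b false) (b true) := by
  rw [sum_unit_labels, sum_bool_labels]
  simp only [sigmaProd, Fintype.univ_bool, Finset.sum_insert, Finset.mem_singleton,
    Bool.true_eq_false, not_false_eq_true, Finset.sum_singleton, Finset.prod_insert,
    Finset.prod_singleton, Finset.univ_unique, cond_true, cond_false]
  generalize b false = x
  generalize b true = y
  generalize a default = z
  cases x <;> cases y <;> cases z <;> simp [comulCoeff, sigmaCoeff]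

theorem sum_sigmaCoeff (a c : Bool) :
    ∑ b, (sigmaCoeff a b : F[X]).comp (-X) * sigmaCoeff b c = if a = c then 1 else 0 := by
  cases a <;> cases c <;> simp [sigmaCoeff]

/-- The matrix form of `σ̂² = id`. The sum over labellings factors over the circles; the first
matrix is conjugated by `h ↦ -h` because of semilinearity. -/
theorem sum_sigmaProd {V : Type*} [Fintype V] [DecidableEq V] (s u : V → Bool) :
    ∑ t, (sigmaProd s t : F[X]).comp (-X) * sigmaProd t u = if s = u then 1 else 0 := by
  simp only [sigmaProd, prod_comp, ← Finset.prod_mul_distrib]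
  have := Finset.prod_univ_sum (fun _ : V => (Finset.univ : Finset Bool))
    (fun q b => (sigmaCoeff (s q) b : F[X]).comp (-X) * sigmaCoeff b (u q))
  rw [Fintype.piFinset_univ] at this
  rw [← this]
  simp only [sum_sigmaCoeff]
  rw [Finset.prod_ite_zero]
  simp [funext_iff]

variable (D : LinkDiagram)

/-- Where two circles at `v` are merged into one circle at `w`, the remaining circles at `v` and `w`
correspond to each other. -/
theorem exists_circle_equiv {v w : D.Vertex} {c : Fin D.n} (h : ∀ j, j ≠ c → v j = w j)
    (hv : D.circleOf v (Sum.inl (c, 0)) ≠ D.circleOf v (Sum.inl (c, 2)))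
    (hw : D.circleOf w (Sum.inl (c, 0)) = D.circleOf w (Sum.inl (c, 2))) :
    ∃ (R : Type) (_ : Finite R) (e : Bool ⊕ R ≃ D.Circle v) (e' : Unit ⊕ R ≃ D.Circle w),
      e (Sum.inl false) = D.circleOf v (Sum.inl (c, 0)) ∧
      e (Sum.inl true) = D.circleOf v (Sum.inl (c, 2)) ∧
      e' (Sum.inl ()) = D.circleOf w (Sum.inl (c, 0)) ∧
      ∀ r, ∃ p, ¬ D.Through v c p ∧ D.circleOf v p = e (Sum.inr r) ∧
        D.circleOf w p = e' (Sum.inr r) := by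
  have h' : ∀ j, j ≠ c → w j = v j := fun j hj => (h j hj).symm
  let R := {q : D.Circle v //
    q ≠ D.circleOf v (Sum.inl (c, 0)) ∧ q ≠ D.circleOf v (Sum.inl (c, 2))}
  choose lift hlift using D.circleOf_surjective v
  have hR : ∀ r : R, ¬ D.Through v c (lift r.1) := by
    rintro ⟨q, hq0, hq2⟩ (h | h)
    · exact hq0 (by rw [← h, hlift])
    · exact hq2 (by rw [← h, hlift])
  let f : Bool ⊕ R → D.Circle v := Sum.elim
    (fun b => bif b then D.circleOf v (Sum.inl (c, 2)) else D.circleOf v (Sum.inl (c, 0)))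
    Subtype.val
  let f' : Unit ⊕ R → D.Circle w := Sum.elim (fun _ => D.circleOf w (Sum.inl (c, 0)))
    (fun r => D.circleOf w (lift r.1))
  have hf : Function.Bijective f := by
    constructor
    · rintro (b | r) (b' | r') hbr
      · cases b <;> cases b'
        · rfl
        · exact absurd hbr hv
        · exact absurd hbr.symm hv
        · rfl
      · cases b
        · exact absurd hbr.symm r'.2.1
        · exact absurd hbr.symm r'.2.2
      · cases b'
        · exact absurd hbr r.2.1
        · exact absurd hbr r.2.2
      · exact congrArg Sum.inr (Subtype.ext hbr)
    · intro q
      by_cases h0 : q = D.circleOf v (Sum.inl (c, 0))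
      · exact ⟨Sum.inl false, h0.symm⟩
      by_cases h2 : q = D.circleOf v (Sum.inl (c, 2))
      · exact ⟨Sum.inl true, h2.symm⟩
      exact ⟨Sum.inr ⟨q, h0, h2⟩, rfl⟩
  have hf' : Function.Bijective f' := by
    constructor
    · rintro (b | r) (b' | r') hbr
      · rfl
      · exact absurd (Through.change h' (Or.inl hbr.symm)) (hR r')
      · exact absurd (Through.change h' (Or.inl hbr)) (hR r)
      · have := circleOf_eq_change h' (fun ht => hR r (Through.change h' ht)) hbr
        rw [hlift, hlift] at this
        exact congrArg Sum.inr (Subtype.ext this)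
    · intro q
      obtain ⟨p, rfl⟩ := D.circleOf_surjective w q
      by_cases hp : D.Through v c p
      · refine ⟨Sum.inl (), ?_⟩
        rcases Through.change h hp with hp | hp
        · exact hp.symm
        · exact (hp.trans hw.symm).symm
      · refine ⟨Sum.inr ⟨D.circleOf v p, fun h0 => hp (Or.inl h0), fun h2 => hp (Or.inr h2)⟩, ?_⟩
        refine (circleOf_eq_change h hp ?_).symm
        exact (hlift _).symm
  exact ⟨R, inferInstance, Equiv.ofBijective f hf, Equiv.ofBijective f' hf', rfl, rfl, rfl,
    fun r => ⟨lift r.1, hR r, hlift _, rfl⟩⟩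

variable {D}

/-- Turns the condition on labels in `edgeCoeff`, quantified over points, into the identity on the
`R`-factors required by `sum_mul_sigmaProd_of_local`. It serves merges and splits alike. -/
theorem label_eq_iff {v w : D.Vertex} {c : Fin D.n} (h : ∀ j, j ≠ c → v j = w j) {I J R : Type}
    {e : I ⊕ R ≃ D.Circle v} {e' : J ⊕ R ≃ D.Circle w}
    (he : ∀ i, e (Sum.inl i) = D.circleOf v (Sum.inl (c, 0)) ∨
      e (Sum.inl i) = D.circleOf v (Sum.inl (c, 2)))
    (hR : ∀ r, ∃ p, ¬ D.Through v c p ∧ D.circleOf v p = e (Sum.inr r) ∧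
        D.circleOf w p = e' (Sum.inr r)) (s : D.Circle v → Bool) (t : D.Circle w → Bool) :
    (∀ p : D.Point, D.circleOf v p ≠ D.circleOf v (Sum.inl (c, 0)) →
        D.circleOf v p ≠ D.circleOf v (Sum.inl (c, 2)) →
        s (D.circleOf v p) = t (D.circleOf w p)) ↔
      (fun r => s (e (Sum.inr r))) = (fun r => t (e' (Sum.inr r))) := by
  constructor
  · intro hp
    funext r
    obtain ⟨p, hpt, hpv, hpw⟩ := hR r
    rw [← hpv, ← hpw]
    exact hp p (fun h0 => hpt (Or.inl h0)) (fun h2 => hpt (Or.inr h2))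
  · intro hst p h0 h2
    obtain ⟨x, hx⟩ := e.surjective (D.circleOf v p)
    rcases x with i | r
    · rcases he i with hi | hi
      · exact absurd (hx.symm.trans hi) h0
      · exact absurd (hx.symm.trans hi) h2
    · obtain ⟨q, hqt, hqv, hqw⟩ := hR r
      have := circleOf_eq_change h hqt (hqv.trans hx)
      rw [← hx, ← this, hqw]
      exact congrFun hst r

open Classical in
theorem edgeCoeff_mk {c : Fin D.n} {v w : D.Vertex} (hv : v c = false)
    (hw : w = Function.update v c true) (s : D.Circle v → Bool) (t : D.Circle w → Bool) :
    (D.edgeCoeff c ⟨v, s⟩ ⟨w, t⟩ : F[X]) =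
      if (∀ p : D.Point, D.circleOf v p ≠ D.circleOf v (Sum.inl (c, 0)) →
          D.circleOf v p ≠ D.circleOf v (Sum.inl (c, 2)) →
          s (D.circleOf v p) = t (D.circleOf w p)) then
        if D.circleOf v (Sum.inl (c, 0)) ≠ D.circleOf v (Sum.inl (c, 2)) then
          mulCoeff (s (D.circleOf v (Sum.inl (c, 0)))) (s (D.circleOf v (Sum.inl (c, 2))))
            (t (D.circleOf w (Sum.inl (c, 0))))
        else if D.circleOf w (Sum.inl (c, 0)) ≠ D.circleOf w (Sum.inl (c, 2)) then
          comulCoeff (s (D.circleOf v (Sum.inl (c, 0)))) (t (D.circleOf w (Sum.inl (c, 0))))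
            (t (D.circleOf w (Sum.inl (c, 2))))
        else 0
      else 0 := by
  unfold edgeCoeff
  simp only [hv, ← hw, true_and]
  rfl

theorem edgeCoeff_intertwines (c : Fin D.n) (v w : D.Vertex) (s : D.Circle v → Bool)
    (t : D.Circle w → Bool) :
    ∑ t', (D.edgeCoeff c ⟨v, s⟩ ⟨w, t'⟩ : F[X]).comp (-X) * sigmaProd t' t =
      ∑ s', sigmaProd s s' * D.edgeCoeff c ⟨v, s'⟩ ⟨w, t⟩ := by
  by_cases hvw : v c = false ∧ w = Function.update v c true
  swap
  · have h0 : ∀ s t, (D.edgeCoeff c ⟨v, s⟩ ⟨w, t⟩ : F[X]) = 0 := fun s t =>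
      if_neg (fun hh => hvw ⟨hh.1, hh.2.1⟩)
    simp [h0]
  have h : ∀ j, j ≠ c → v j = w j := fun j hj => by rw [hvw.2, Function.update_of_ne hj]
  have h' : ∀ j, j ≠ c → w j = v j := fun j hj => (h j hj).symm
  have hwc : w c = true := by rw [hvw.2, Function.update_self]
  by_cases hv : D.circleOf v (Sum.inl (c, 0)) = D.circleOf v (Sum.inl (c, 2))
  · by_cases hw : D.circleOf w (Sum.inl (c, 0)) = D.circleOf w (Sum.inl (c, 2))
    -- Neither a merge nor a split: `edgeCoeff` is zero by definition, so planarity need not be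
    -- invoked.
    · simp [edgeCoeff_mk hvw.1 hvw.2, hv, hw]
    -- A split is a merge read backwards, so the correspondence is taken from `w` to `v`.
    · obtain ⟨R, _, e', e, he0, he2, he, hR⟩ := D.exists_circle_equiv h' hw hv
      have := Fintype.ofFinite R
      have := Classical.decEq R
      have hR' : ∀ r, ∃ p, ¬ D.Through v c p ∧ D.circleOf v p = e (Sum.inr r) ∧
          D.circleOf w p = e' (Sum.inr r) := fun r => by
        obtain ⟨p, hp, hpw, hpv⟩ := hR r
        exact ⟨p, fun ht => hp (ht.change h), hpv, hpw⟩
      refine sum_mul_sigmaProd_of_local e e' (fun a b => comulCoeff (a ()) (b false) (b true))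
        (fun s t => D.edgeCoeff c ⟨v, s⟩ ⟨w, t⟩) (fun s t => ?_) comulCoeff_intertwines s t
      have key := label_eq_iff h (fun _ => Or.inl he) hR' s t
      simp only [edgeCoeff_mk hvw.1 hvw.2, key, he, he0, he2]
      rw [if_neg (not_not.2 hv), if_pos hw]
  · have hw := circleOf_merge h hvw.1 hwc hv
    obtain ⟨R, _, e, e', he0, he2, he, hR⟩ := D.exists_circle_equiv h hv hw
    have := Fintype.ofFinite R
    have := Classical.decEq R
    refine sum_mul_sigmaProd_of_local e e' (fun a b => mulCoeff (a false) (a true) (b ()))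
      (fun s t => D.edgeCoeff c ⟨v, s⟩ ⟨w, t⟩) (fun s t => ?_) mulCoeff_intertwines s t
    have key := label_eq_iff h (fun b => by cases b; exacts [Or.inl he0, Or.inr he2]) hR s t
    simp only [edgeCoeff_mk hvw.1 hvw.2, key, he, he0, he2, ne_eq, hv, not_false_eq_true, if_true]

end Intertwining

/-! ### The involution on chains: semilinearity, order two, commutation with the differential -/

section Involution

variable {F : Type*} [Field F] {D : LinkDiagram}

variable (F) in
/-- The entry of the matrix of the differential from `S` to `T`. -/
noncomputable def dCoeff (S T : D.EnhancedState) : F[X] :=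
  ∑ c : Fin D.n,
    (-1) ^ (Finset.univ.filter fun j => j < c ∧ S.1 j = true).card * D.edgeCoeff c S T

theorem d_apply (x : D.Chain F) (T : D.EnhancedState) :
    D.d F x T = ∑ v : D.Vertex, ∑ s : D.Circle v → Bool, dCoeff F ⟨v, s⟩ T * x ⟨v, s⟩ := by
  rw [← Fintype.sum_sigma' (fun (v : D.Vertex) s => dCoeff F ⟨v, s⟩ T * x ⟨v, s⟩)]
  rfl

theorem sigmaHat_apply (x : D.Chain F) (v : D.Vertex) (t : D.Circle v → Bool) :
    D.sigmaHat x ⟨v, t⟩ = ∑ s, (x ⟨v, s⟩).comp (-X) * sigmaProd s t := rfl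

theorem sum_comp_neg_X {ι : Type*} (s : Finset ι) (f : ι → F[X]) :
    (∑ i ∈ s, f i).comp (-X) = ∑ i ∈ s, (f i).comp (-X) :=
  map_sum (compRingHom (-X : F[X])) f s

theorem dCoeff_intertwines (v w : D.Vertex) (s : D.Circle v → Bool) (t : D.Circle w → Bool) :
    ∑ t', (dCoeff F ⟨v, s⟩ ⟨w, t'⟩).comp (-X) * sigmaProd t' t =
      ∑ s', sigmaProd s s' * dCoeff F ⟨v, s'⟩ ⟨w, t⟩ := by
  simp only [dCoeff, sum_comp_neg_X, Finset.sum_mul, Finset.mul_sum]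
  rw [Finset.sum_comm, Finset.sum_comm (s := (Finset.univ : Finset (D.Circle v → Bool)))]
  refine Finset.sum_congr rfl fun c _ => ?_
  simp only [mul_comp, pow_comp, neg_comp, one_comp, mul_assoc,
    mul_left_comm (sigmaProd s _)]
  rw [← Finset.mul_sum, ← Finset.mul_sum, edgeCoeff_intertwines]

theorem sigmaHat_add (x y : D.Chain F) : D.sigmaHat (x + y) = D.sigmaHat x + D.sigmaHat y := by
  funext ⟨v, t⟩
  simp only [sigmaHat_apply, Pi.add_apply, add_comp, add_mul, Finset.sum_add_distrib]

theorem sigmaHat_smul (f : F[X]) (x : D.Chain F) :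
    D.sigmaHat (f • x) = f.comp (-X) • D.sigmaHat x := by
  funext ⟨v, t⟩
  simp only [sigmaHat_apply, Pi.smul_apply, smul_eq_mul, mul_comp, Finset.mul_sum, mul_assoc]

theorem comp_neg_X_comp_neg_X (f : F[X]) : (f.comp (-X)).comp (-X) = f := by
  simp [comp_assoc]

theorem sigmaHat_sigmaHat (x : D.Chain F) : D.sigmaHat (D.sigmaHat x) = x := by
  funext ⟨v, t⟩
  simp only [sigmaHat_apply, sum_comp_neg_X, mul_comp, comp_neg_X_comp_neg_X, Finset.sum_mul]
  rw [Finset.sum_comm]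
  simp only [mul_assoc, ← Finset.mul_sum, sum_sigmaProd, mul_ite, mul_one, mul_zero,
    Finset.sum_ite_eq', Finset.mem_univ, if_true]

/-- The graded involution commutes with the differential. -/
theorem sigmaHat_d (x : D.Chain F) : D.sigmaHat (D.d F x) = D.d F (D.sigmaHat x) := by
  funext ⟨w, t⟩
  simp only [sigmaHat_apply, d_apply, sum_comp_neg_X, mul_comp, Finset.sum_mul, Finset.mul_sum]
  rw [Finset.sum_comm]
  refine Finset.sum_congr rfl fun v _ => ?_
  rw [Finset.sum_comm, Finset.sum_comm (s := (Finset.univ : Finset (D.Circle v → Bool)))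
    (t := (Finset.univ : Finset (D.Circle v → Bool)))]
  refine Finset.sum_congr rfl fun s _ => ?_
  have := congrArg (fun f => (x ⟨v, s⟩).comp (-X) * f) (dCoeff_intertwines (F := F) v w s t)
  simp only [Finset.mul_sum] at this
  calc _ = _ := Finset.sum_congr rfl fun t' _ => by ring
    _ = _ := this
    _ = _ := Finset.sum_congr rfl fun s' _ => by ring

end Involution

/-! ### The subcomplexes `C_X` and `C_Y` -/

section Reduced

variable {F : Type*} [Field F] {D : LinkDiagram} {p : D.Point}

theorem label_relabelOne (S : D.EnhancedState) : (S.relabelOne p).label p = false := by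
  simp [EnhancedState.label, EnhancedState.relabelOne]

theorem exists_relabelOne_eq {S : D.EnhancedState} (h : S.label p = false) :
    ∃ S' : D.EnhancedState, S'.label p = true ∧ S'.relabelOne p = S := by
  refine ⟨⟨S.1, Function.update S.2 (D.circleOf S.1 p) true⟩, ?_, ?_⟩
  · simp [EnhancedState.label]
  · obtain ⟨v, s⟩ := S
    have h' : false = s (D.circleOf v p) := h.symm
    simp [EnhancedState.relabelOne, h']

theorem relabelOne_inj {S S' : D.EnhancedState} (h : S.label p = true) (h' : S'.label p = true) :
    S.relabelOne p = S'.relabelOne p ↔ S = S' := by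
  refine ⟨fun heq => ?_, fun heq => heq ▸ rfl⟩
  obtain ⟨v, s⟩ := S
  obtain ⟨v', s'⟩ := S'
  obtain rfl : v = v' := congrArg Sigma.fst heq
  have h1 : s (D.circleOf v p) = true := h
  have h2 : s' (D.circleOf v p) = true := h'
  have heq' : Function.update s (D.circleOf v p) false =
      Function.update s' (D.circleOf v p) false := eq_of_heq (Sigma.mk.inj heq).2
  congr 1
  funext q
  by_cases hq : q = D.circleOf v p
  · rw [hq, h1, h2]
  · simpa [hq] using congrFun heq' q

theorem mem_chainX_iff {x : D.Chain F} :
    x ∈ D.chainX F p ↔ ∀ S : D.EnhancedState, S.label p = false → x S = 0 := by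
  constructor
  · intro hx S hS
    induction hx using Submodule.span_induction with
    | mem x hx =>
      obtain ⟨S', hS', rfl⟩ := hx
      refine Pi.single_eq_of_ne (fun h => ?_) _
      rw [h, hS'] at hS
      exact Bool.noConfusion hS
    | zero => rfl
    | add x y _ _ hx hy => rw [Pi.add_apply, hx, hy, add_zero]
    | smul f x _ hx => rw [Pi.smul_apply, hx, smul_zero]
  · intro hx
    rw [pi_eq_sum_univ' x]
    refine Submodule.sum_mem _ fun S _ => ?_
    cases hS : S.label p
    · rw [hx S hS, zero_smul]
      exact Submodule.zero_mem _
    · refine Submodule.smul_mem _ _ (Submodule.subset_span ⟨S, hS, ?_⟩)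
      funext T
      simp [Pi.single_apply, eq_comm]

theorem ne_of_label {S T : D.EnhancedState} (hS : S.label p = true) (hT : T.label p = false) :
    S ≠ T := by
  rintro rfl
  rw [hS] at hT
  exact Bool.noConfusion hT

theorem chainY_rel {x : D.Chain F} (hx : x ∈ D.chainY F p) {S : D.EnhancedState}
    (hS : S.label p = true) : x (S.relabelOne p) = -X * x S := by
  induction hx using Submodule.span_induction with
  | mem x hx =>
    obtain ⟨S', hS', rfl⟩ := hx
    have h1 := ne_of_label hS (label_relabelOne (p := p) S')
    have h2 := (ne_of_label hS' (label_relabelOne (p := p) S)).symm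
    simp only [Pi.sub_apply, Pi.smul_apply, Pi.single_apply, h1, h2, relabelOne_inj hS hS',
      smul_eq_mul, if_false]
    split_ifs <;> simp
  | zero => simp
  | add x y _ _ hx hy => rw [Pi.add_apply, hx, hy, Pi.add_apply, mul_add]
  | smul f x _ hx => rw [Pi.smul_apply, hx, Pi.smul_apply, smul_eq_mul, smul_eq_mul, mul_left_comm]

/-- As `Y = X - h`, a multiple of `Y` is determined by its coefficients at the label `X`, those at
the label `1` being `-h` times them. -/
theorem mem_chainY_iff {x : D.Chain F} :
    x ∈ D.chainY F p ↔
      ∀ S : D.EnhancedState, S.label p = true → x (S.relabelOne p) = -X * x S := by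
  refine ⟨fun hx S hS => chainY_rel hx hS, fun hx => ?_⟩
  let y : D.Chain F := ∑ S : D.EnhancedState, if S.label p = true then
    x S • (Pi.single S 1 - (X : F[X]) • Pi.single (S.relabelOne p) 1) else 0
  have hy : y ∈ D.chainY F p := by
    refine Submodule.sum_mem _ fun S _ => ?_
    split_ifs with hS
    · exact Submodule.smul_mem _ _ (Submodule.subset_span ⟨S, hS, rfl⟩)
    · exact Submodule.zero_mem _
  have hxy : ∀ S : D.EnhancedState, S.label p = true → x S = y S := by
    intro S hS
    simp only [y, Finset.sum_apply]
    rw [Finset.sum_eq_single S]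
    · simp [hS, ne_of_label hS (label_relabelOne (p := p) S)]
    · intro S' _ hne
      split_ifs
      · simp [hne.symm, ne_of_label hS (label_relabelOne (p := p) S')]
      · rfl
    · simp
  have : x = y := by
    funext S
    cases hS : S.label p
    · obtain ⟨S', hS', rfl⟩ := exists_relabelOne_eq hS
      rw [hx S' hS', chainY_rel hy hS', hxy S' hS']
    · exact hxy S hS
  rwa [this]

theorem sigmaProd_eq_mul_erase {V : Type*} [Fintype V] [DecidableEq V] (s t : V → Bool) (q : V) :
    (sigmaProd s t : F[X]) =
      sigmaCoeff (s q) (t q) * ∏ r ∈ Finset.univ.erase q, sigmaCoeff (s r) (t r) :=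
  (Finset.mul_prod_erase _ _ (Finset.mem_univ q)).symm

theorem sigmaProd_update_right {V : Type*} [Fintype V] [DecidableEq V] {s t : V → Bool} {q : V}
    (hs : s q = true) (ht : t q = true) :
    (sigmaProd s (Function.update t q false) : F[X]) = -X * sigmaProd s t := by
  rw [sigmaProd_eq_mul_erase _ _ q, sigmaProd_eq_mul_erase s t q, Function.update_self, hs, ht]
  have : ∏ r ∈ Finset.univ.erase q, (sigmaCoeff (s r) (Function.update t q false r) : F[X]) =
      ∏ r ∈ Finset.univ.erase q, sigmaCoeff (s r) (t r) :=
    Finset.prod_congr rfl fun r hr => by rw [Function.update_of_ne (Finset.ne_of_mem_erase hr)]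
  rw [this]
  simp [sigmaCoeff]

theorem sigmaProd_update_left {V : Type*} [Fintype V] [DecidableEq V] {s t : V → Bool} {q : V}
    (hs : s q = true) (ht : t q = false) :
    (sigmaProd s t : F[X]) = -X * sigmaProd (Function.update s q false) t := by
  rw [sigmaProd_eq_mul_erase _ _ q, sigmaProd_eq_mul_erase _ t q, Function.update_self, hs, ht]
  have : ∏ r ∈ Finset.univ.erase q, (sigmaCoeff (Function.update s q false r) (t r) : F[X]) =
      ∏ r ∈ Finset.univ.erase q, sigmaCoeff (s r) (t r) :=
    Finset.prod_congr rfl fun r hr => by rw [Function.update_of_ne (Finset.ne_of_mem_erase hr)]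
  rw [this]
  simp [sigmaCoeff]

theorem sigmaHat_mem_chainY {x : D.Chain F} (hx : x ∈ D.chainX F p) :
    D.sigmaHat x ∈ D.chainY F p := by
  rw [mem_chainX_iff] at hx
  rw [mem_chainY_iff]
  rintro ⟨v, t⟩ ht
  change D.sigmaHat x ⟨v, Function.update t (D.circleOf v p) false⟩ = _
  rw [sigmaHat_apply, sigmaHat_apply, Finset.mul_sum]
  refine Finset.sum_congr rfl fun s _ => ?_
  cases hs : s (D.circleOf v p)
  · rw [hx ⟨v, s⟩ hs]
    simp
  · rw [sigmaProd_update_right hs ht]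
    ring

theorem sigmaHat_mem_chainX {x : D.Chain F} (hx : x ∈ D.chainY F p) :
    D.sigmaHat x ∈ D.chainX F p := by
  rw [mem_chainX_iff]
  rintro ⟨v, t⟩ ht
  rw [sigmaHat_apply]
  -- The two labels of the circle through `p` contribute opposite terms, so flipping that label is
  -- an involution that cancels the sum.
  have key : ∀ s : D.Circle v → Bool, s (D.circleOf v p) = true →
      (x ⟨v, s⟩).comp (-X) * sigmaProd s t +
        (x ⟨v, Function.update s (D.circleOf v p) false⟩).comp (-X) *
          sigmaProd (Function.update s (D.circleOf v p) false) t = 0 := by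
    intro s hs
    have h1 : x ⟨v, Function.update s (D.circleOf v p) false⟩ = -X * x ⟨v, s⟩ :=
      chainY_rel (S := ⟨v, s⟩) hx hs
    rw [h1, sigmaProd_update_left hs ht]
    simp only [mul_comp, neg_comp, X_comp]
    ring
  refine Finset.sum_involution
    (fun s _ => Function.update s (D.circleOf v p) (!s (D.circleOf v p))) (fun s _ => ?_)
    (fun s _ _ h => ?_) (fun _ _ => Finset.mem_univ _) (fun s _ => by simp)
  · cases hs : s (D.circleOf v p)
    · have := key (Function.update s (D.circleOf v p) true) (by simp)
      rw [Function.update_idem, ← hs, Function.update_eq_self] at this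
      rw [add_comm]
      simpa [hs] using this
    · exact key s hs
  · have := congrFun h (D.circleOf v p)
    simp at this

/-- The label `X` at the base point persists: products with `X` are multiples of `X`, and `Δ(X) = X
⊗ X`. -/
theorem edgeCoeff_eq_zero {c : Fin D.n} {S T : D.EnhancedState} (hS : S.label p = true)
    (hT : T.label p = false) : (D.edgeCoeff c S T : F[X]) = 0 := by
  obtain ⟨v, s⟩ := S
  obtain ⟨w, t⟩ := T
  have hS' : s (D.circleOf v p) = true := hS
  have hT' : t (D.circleOf w p) = false := hT
  by_cases hvw : v c = false ∧ w = Function.update v c true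
  swap
  · exact if_neg (fun hh => hvw ⟨hh.1, hh.2.1⟩)
  have h : ∀ j, j ≠ c → v j = w j := fun j hj => by rw [hvw.2, Function.update_of_ne hj]
  have hwc : w c = true := by rw [hvw.2, Function.update_self]
  rw [edgeCoeff_mk hvw.1 hvw.2]
  split_ifs with h1 h2 h3
  · by_cases hp : D.Through v c p
    · have hw : t (D.circleOf w (Sum.inl (c, 0))) = false := by
        rw [← hT']
        rcases hp.change h with hq | hq
        · rw [hq]
        · rw [hq, circleOf_merge h hvw.1 hwc h2]
      rw [hw]
      rcases hp with hq | hq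
      · rw [← hq, hS']
        generalize s _ = a
        cases a <;> rfl
      · rw [← hq, hS']
        generalize s _ = a
        cases a <;> rfl
    · have := h1 p (fun h => hp (Or.inl h)) (fun h => hp (Or.inr h))
      rw [hS', hT'] at this
      exact Bool.noConfusion this
  · by_cases hp : D.Through v c p
    · have hv : s (D.circleOf v (Sum.inl (c, 0))) = true := by
        rw [← hS']
        rcases hp with hq | hq
        · rw [hq]
        · rw [hq, not_not.1 h2]
      rw [hv]
      rcases hp.change h with hq | hq
      · rw [← hq, hT']
        generalize t _ = a
        cases a <;> rfl
      · rw [← hq, hT']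
        generalize t _ = a
        cases a <;> rfl
    · have := h1 p (fun h => hp (Or.inl h)) (fun h => hp (Or.inr h))
      rw [hS', hT'] at this
      exact Bool.noConfusion this
  · rfl
  · rfl

theorem d_mem_chainX {x : D.Chain F} (hx : x ∈ D.chainX F p) : D.d F x ∈ D.chainX F p := by
  rw [mem_chainX_iff] at hx ⊢
  intro T hT
  rw [d_apply]
  refine Finset.sum_eq_zero fun v _ => Finset.sum_eq_zero fun s _ => ?_
  cases hS : EnhancedState.label (⟨v, s⟩ : D.EnhancedState) p
  · rw [hx _ hS, mul_zero]
  · rw [dCoeff, Finset.sum_eq_zero fun c _ => by rw [edgeCoeff_eq_zero hS hT, mul_zero], zero_mul]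

theorem d_mem_chainY {x : D.Chain F} (hx : x ∈ D.chainY F p) : D.d F x ∈ D.chainY F p := by
  have := sigmaHat_mem_chainY (d_mem_chainX (sigmaHat_mem_chainX hx))
  rwa [← sigmaHat_d, sigmaHat_sigmaHat] at this

theorem eq_zero_of_mem_chainX_of_mem_chainY {x : D.Chain F} (hX : x ∈ D.chainX F p)
    (hY : x ∈ D.chainY F p) : x = 0 := by
  rw [mem_chainX_iff] at hX
  funext S
  cases hS : S.label p
  · exact hX S hS
  · have := chainY_rel hY hS
    rw [hX _ (label_relabelOne S)] at this
    simpa using this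

theorem exists_add_eq_X_smul (p : D.Point) (x : D.Chain F) :
    ∃ u ∈ D.chainX F p, ∃ y ∈ D.chainY F p, u + y = (X : F[X]) • x := by
  -- On the factor of the base point, `h (a + b X) = (a + h b) X - a Y`; the chain `y` is the
  -- component `-a Y`.
  let y : D.Chain F := fun S => if S.label p = true then -x (S.relabelOne p) else X * x S
  refine ⟨(X : F[X]) • x - y, ?_, y, ?_, by simp⟩
  · rw [mem_chainX_iff]
    intro S hS
    simp [y, hS]
  · rw [mem_chainY_iff]
    intro S hS
    simp [y, hS, label_relabelOne]

theorem mem_chainX_of_X_smul_mem {x : D.Chain F} (hx : (X : F[X]) • x ∈ D.chainX F p) :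
    x ∈ D.chainX F p := by
  rw [mem_chainX_iff] at hx ⊢
  intro S hS
  simpa using hx S hS

theorem mem_chainY_of_X_smul_mem {x : D.Chain F} (hx : (X : F[X]) • x ∈ D.chainY F p) :
    x ∈ D.chainY F p := by
  rw [mem_chainY_iff] at hx ⊢
  intro S hS
  have := hx S hS
  simp only [Pi.smul_apply, smul_eq_mul] at this
  rw [mul_left_comm] at this
  exact mul_left_cancel₀ X_ne_zero this

end Reduced

/-! ### Algebra of the operation `ν̂` -/

section Shumakovitch

variable {F : Type*} [Field F] {D : LinkDiagram}

theorem X_smul_cancel {x y : D.Chain F} (h : (X : F[X]) • x = (X : F[X]) • y) : x = y := by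
  funext S
  have := congrFun h S
  simpa using this

theorem nuHat_add (x y : D.Chain F) : D.nuHat (x + y) = D.nuHat x + D.nuHat y := by
  apply X_smul_cancel
  rw [smul_add, X_smul_nuHat, X_smul_nuHat, X_smul_nuHat, sigmaHat_add]
  abel

theorem nuHat_zero : D.nuHat (0 : D.Chain F) = 0 := by
  have := nuHat_add (0 : D.Chain F) 0
  simpa using this

theorem nuHat_neg (x : D.Chain F) : D.nuHat (-x) = -D.nuHat x := by
  rw [eq_neg_iff_add_eq_zero, ← nuHat_add, neg_add_cancel, nuHat_zero]

theorem nuHat_sub (x y : D.Chain F) : D.nuHat (x - y) = D.nuHat x - D.nuHat y := by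
  rw [sub_eq_add_neg, nuHat_add, nuHat_neg, sub_eq_add_neg]

theorem nuHat_sum {ι : Type*} (s : Finset ι) (x : ι → D.Chain F) :
    D.nuHat (∑ i ∈ s, x i) = ∑ i ∈ s, D.nuHat (x i) :=
  map_sum (AddMonoidHom.mk' D.nuHat nuHat_add) x s

theorem nuHat_d (x : D.Chain F) : D.nuHat (D.d F x) = D.d F (D.nuHat x) := by
  apply X_smul_cancel
  rw [← map_smul, X_smul_nuHat, X_smul_nuHat, sigmaHat_d, map_sub]

theorem nuHat_smul_of_comp_eq {f : F[X]} (hf : f.comp (-X) = f) (x : D.Chain F) :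
    D.nuHat (f • x) = f • D.nuHat x := by
  apply X_smul_cancel
  rw [smul_comm, X_smul_nuHat, X_smul_nuHat, sigmaHat_smul, hf, smul_sub]

/-- A twisted Leibniz rule with `g = (f - f(-h)) / h`. It matters that `g` does not depend on `x`,
so that the correction is a multiple of the same chain. -/
theorem exists_nuHat_smul (f : F[X]) :
    ∃ g : F[X], ∀ x : D.Chain F, D.nuHat (f • x) = f.comp (-X) • D.nuHat x + g • x := by
  have h : X ∣ f - f.comp (-X) := by
    rw [X_dvd_iff, coeff_zero_eq_eval_zero]
    simp [eval_comp]
  obtain ⟨g, hg⟩ := h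
  refine ⟨g, fun x => X_smul_cancel ?_⟩
  rw [smul_add, smul_comm, X_smul_nuHat, X_smul_nuHat, sigmaHat_smul, smul_smul, ← hg, smul_sub,
    sub_smul]
  abel

/-! ### The splitting of the Khovanov complex by `ν̂` -/

/-- `C'` and `C''` are exchanged by the graded involution, and their direct sum is a subcomplex of
the Khovanov complex that becomes everything when `h` is inverted. -/
structure IsSigmaPair (C' C'' : Submodule F[X] (D.Chain F)) : Prop where
  sigmaHat_mem : ∀ x ∈ C', D.sigmaHat x ∈ C''
  sigmaHat_mem' : ∀ x ∈ C'', D.sigmaHat x ∈ C'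
  d_mem : ∀ x ∈ C', D.d F x ∈ C'
  disjoint : ∀ x ∈ C', x ∈ C'' → x = 0
  exists_add : ∀ x, ∃ u ∈ C', ∃ y ∈ C'', u + y = (X : F[X]) • x
  saturated : ∀ x, (X : F[X]) • x ∈ C' → x ∈ C'

theorem isSigmaPair_chainX_chainY (p : D.Point) :
    IsSigmaPair (D.chainX F p) (D.chainY F p) where
  sigmaHat_mem _ := sigmaHat_mem_chainY
  sigmaHat_mem' _ := sigmaHat_mem_chainX
  d_mem _ := d_mem_chainX
  disjoint _ := eq_zero_of_mem_chainX_of_mem_chainY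
  exists_add := exists_add_eq_X_smul p
  saturated _ := mem_chainX_of_X_smul_mem

theorem isSigmaPair_chainY_chainX (p : D.Point) :
    IsSigmaPair (D.chainY F p) (D.chainX F p) where
  sigmaHat_mem _ := sigmaHat_mem_chainX
  sigmaHat_mem' _ := sigmaHat_mem_chainY
  d_mem _ := d_mem_chainY
  disjoint _ hY hX := eq_zero_of_mem_chainX_of_mem_chainY hX hY
  exists_add x := by
    obtain ⟨u, hu, y, hy, h⟩ := exists_add_eq_X_smul p x
    exact ⟨y, hy, u, hu, (add_comm _ _).trans h⟩
  saturated _ := mem_chainY_of_X_smul_mem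

namespace IsSigmaPair

variable {C' C'' : Submodule F[X] (D.Chain F)} (hC : IsSigmaPair C' C'')
include hC

theorem eq_zero_of_nuHat_mem {w : D.Chain F} (hw : w ∈ C') (h : D.nuHat w ∈ C') : w = 0 := by
  have h1 : D.sigmaHat w = w - (X : F[X]) • D.nuHat w := by rw [X_smul_nuHat]; abel
  have h2 : D.sigmaHat w ∈ C' := by
    rw [h1]
    exact sub_mem hw (C'.smul_mem _ h)
  have h3 := hC.disjoint _ h2 (hC.sigmaHat_mem w hw)
  rw [← sigmaHat_sigmaHat w, h3]
  simpa using sigmaHat_smul (D := D) (0 : F[X]) 0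

/-- The Khovanov complex is the direct sum of `C'` and its image under `ν̂`. -/
theorem exists_nuHat_add (x : D.Chain F) : ∃ w ∈ C', ∃ u ∈ C', x = D.nuHat w + u := by
  obtain ⟨u, hu, y, hy, h⟩ := hC.exists_add x
  have hw := hC.sigmaHat_mem' y hy
  -- Since `h ν̂(-σ̂ y) = y - σ̂ y`, subtracting it from `h x = u + y` replaces `y` by `σ̂ y ∈ C'`.
  refine ⟨-D.sigmaHat y, neg_mem hw, _, hC.saturated (x - D.nuHat (-D.sigmaHat y)) ?_, by abel⟩
  rw [smul_sub, ← h, nuHat_neg, smul_neg, X_smul_nuHat, sigmaHat_sigmaHat]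
  convert add_mem hu hw using 1
  abel

/-- The differential acts on both components separately, and directness of the splitting makes each
of them closed. -/
theorem exists_cycles_nuHat_add {x : D.Chain F} (hx : D.d F x = 0) :
    ∃ w ∈ D.cycles C', ∃ u ∈ D.cycles C', x = D.nuHat w + u := by
  obtain ⟨w, hw, u, hu, rfl⟩ := hC.exists_nuHat_add x
  rw [map_add, ← nuHat_d] at hx
  have hdw : D.d F w = 0 := by
    refine hC.eq_zero_of_nuHat_mem (hC.d_mem w hw) ?_
    rw [eq_neg_of_add_eq_zero_left hx]
    exact neg_mem (hC.d_mem u hu)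
  rw [hdw, nuHat_zero, zero_add] at hx
  exact ⟨w, ⟨hw, hdw⟩, u, ⟨hu, hx⟩, rfl⟩

theorem exists_boundary_of_nuHat_add {w u y : D.Chain F} (hw : w ∈ C') (hu : u ∈ C')
    (h : D.nuHat w + u = D.d F y) : (∃ w₁ ∈ C', w = D.d F w₁) ∧
      (w = 0 → ∃ u₁ ∈ C', u = D.d F u₁) := by
  obtain ⟨w₁, hw₁, u₁, hu₁, rfl⟩ := hC.exists_nuHat_add y
  rw [map_add, ← nuHat_d] at h
  have h1 : w - D.d F w₁ = 0 := by
    refine hC.eq_zero_of_nuHat_mem (sub_mem hw (hC.d_mem _ hw₁)) ?_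
    have : D.nuHat (w - D.d F w₁) = D.d F u₁ - u := by
      rw [nuHat_sub, sub_eq_sub_iff_add_eq_add, h, add_comm]
    rw [this]
    exact sub_mem (hC.d_mem _ hu₁) hu
  have h2 := sub_eq_zero.1 h1
  refine ⟨⟨w₁, hw₁, h2⟩, fun hw0 => ⟨u₁, hu₁, ?_⟩⟩
  rw [← h2, hw0, nuHat_zero, zero_add, zero_add] at h
  exact h

end IsSigmaPair

/-! ### Homology modulo torsion and the transfer of bases -/

theorem mem_cycles_top {x : D.Chain F} : x ∈ D.cycles ⊤ ↔ D.d F x = 0 := by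
  simp [cycles]

theorem nuHat_mem_cycles {x : D.Chain F} (hx : D.d F x = 0) : D.nuHat x ∈ D.cycles ⊤ := by
  rw [mem_cycles_top, ← nuHat_d, hx, nuHat_zero]

/-- The map from cycles to homology modulo torsion. -/
noncomputable def classMap (C' : Submodule F[X] (D.Chain F)) :
    D.cycles C' →ₗ[F[X]] D.HomologyModTor C' :=
  (Submodule.mkQ _).comp (Submodule.mkQ _)

theorem classMap_surjective (C' : Submodule F[X] (D.Chain F)) :
    Function.Surjective (classMap C') :=
  (Submodule.mkQ_surjective _).comp (Submodule.mkQ_surjective _)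

theorem classMap_eq_zero_iff {C' : Submodule F[X] (D.Chain F)} {z : D.cycles C'} :
    classMap C' z = 0 ↔ ∃ f : F[X], f ≠ 0 ∧ ∃ y ∈ C', f • (z : D.Chain F) = D.d F y := by
  change Submodule.Quotient.mk (Submodule.Quotient.mk z) = (0 : D.HomologyModTor C') ↔ _
  rw [Submodule.Quotient.mk_eq_zero, Submodule.mem_torsion_iff]
  have key : ∀ f : F[X], f • (Submodule.Quotient.mk z : D.Homology C') = 0 ↔
      ∃ y ∈ C', f • (z : D.Chain F) = D.d F y := by
    intro f
    rw [← Submodule.Quotient.mk_smul, Submodule.Quotient.mk_eq_zero, Submodule.submoduleOf,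
      Submodule.mem_comap, Submodule.mem_map]
    simp [eq_comm]
  constructor
  · rintro ⟨f, hf⟩
    exact ⟨f, nonZeroDivisors.coe_ne_zero f, (key f).1 hf⟩
  · rintro ⟨f, hf, h⟩
    exact ⟨⟨f, mem_nonZeroDivisors_of_ne_zero hf⟩, (key f).2 h⟩

theorem comp_neg_X_ne_zero {f : F[X]} (hf : f ≠ 0) : f.comp (-X) ≠ 0 := by
  intro h
  apply hf
  rw [← comp_neg_X_comp_neg_X f, h, zero_comp]

/-- The operation `ν̂` preserves torsion classes. -/
theorem exists_smul_nuHat_eq {f : F[X]} (hf : f ≠ 0) {x y : D.Chain F} (h : f • x = D.d F y) :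
    ∃ g : F[X], g ≠ 0 ∧ ∃ y', g • D.nuHat x = D.d F y' := by
  -- The multiple `f(-h) f` is even, hence passes through `ν̂`.
  refine ⟨f.comp (-X) * f, mul_ne_zero (comp_neg_X_ne_zero hf) hf, D.nuHat (f.comp (-X) • y), ?_⟩
  rw [← nuHat_smul_of_comp_eq, mul_smul, h, ← map_smul, nuHat_d]
  rw [mul_comp, comp_neg_X_comp_neg_X, mul_comm]

variable {C' C'' : Submodule F[X] (D.Chain F)} {ι : Type*} [Fintype ι]

theorem IsSigmaPair.linearIndependent (hC : IsSigmaPair C' C'') {z : ι → D.Chain F}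
    (hz : ∀ j, z j ∈ D.cycles C') (hz' : ∀ j, z j ∈ D.cycles ⊤)
    (hν : ∀ j, D.nuHat (z j) ∈ D.cycles ⊤)
    (hli : LinearIndependent F[X] fun j => classMap C' ⟨z j, hz j⟩) :
    LinearIndependent F[X] (Sum.elim (fun j => classMap ⊤ ⟨z j, hz' j⟩)
      fun j => classMap ⊤ ⟨D.nuHat (z j), hν j⟩) := by
  have hli' : ∀ a : ι → F[X], (∃ y ∈ C', ∑ j, a j • z j = D.d F y) → ∀ j, a j = 0 := by
    rintro a ⟨y, hy, h⟩
    refine Fintype.linearIndependent_iff.1 hli a ?_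
    simp only [← map_smul]
    rw [← map_sum, classMap_eq_zero_iff]
    exact ⟨1, one_ne_zero, y, hy, by simpa using h⟩
  rw [Fintype.linearIndependent_iff]
  intro g hg
  simp only [Fintype.sum_sum_type, Sum.elim_inl, Sum.elim_inr, ← map_smul] at hg
  rw [← map_sum, ← map_sum, ← map_add, classMap_eq_zero_iff] at hg
  obtain ⟨f, hf, y, -, h⟩ := hg
  -- The coefficients are twisted in advance so that `ν̂` twists them back. This rewrites the
  -- relation as `ν̂ w + u = d y` with `w, u ∈ C'`, the corrections `k j` being absorbed in `u`.
  choose k hk using fun j => exists_nuHat_smul (D := D) ((f * g (Sum.inr j)).comp (-X))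
  simp only [comp_neg_X_comp_neg_X] at hk
  set w : D.Chain F := ∑ j, (f * g (Sum.inr j)).comp (-X) • z j with hw
  set u : D.Chain F := ∑ j, (f * g (Sum.inl j) - k j) • z j with hu
  have hwC : w ∈ C' := sum_mem fun j _ => C'.smul_mem _ (hz j).1
  have huC : u ∈ C' := sum_mem fun j _ => C'.smul_mem _ (hz j).1
  have key : D.nuHat w + u = D.d F y := by
    rw [← h, hw, hu, nuHat_sum]
    simp only [hk, sub_smul, Finset.sum_add_distrib, Finset.sum_sub_distrib, mul_smul,
      ← Finset.smul_sum]
    simp only [Submodule.coe_add, Submodule.coe_sum, Submodule.coe_smul, smul_add]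
    abel
  obtain ⟨h1, h2⟩ := hC.exists_boundary_of_nuHat_add hwC huC key
  have hr : ∀ j, g (Sum.inr j) = 0 := fun j => by
    by_contra hne
    exact comp_neg_X_ne_zero (mul_ne_zero hf hne) (hli' _ h1 j)
  have hw0 : w = 0 := by simp [hw, hr]
  -- With all `g (Sum.inr j)` zero, expanding `ν̂ w = 0` leaves exactly the corrections, so they
  -- drop out of `u`.
  have hk0 : ∑ j, k j • z j = 0 := by
    have := nuHat_sum Finset.univ fun j => (f * g (Sum.inr j)).comp (-X) • z j
    rw [← hw, hw0, nuHat_zero] at this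
    simp only [hk] at this
    simpa [hr] using this.symm
  have hl : ∀ j, f * g (Sum.inl j) = 0 := by
    refine hli' _ ?_
    obtain ⟨u₁, hu₁, h3⟩ := h2 hw0
    refine ⟨u₁, hu₁, ?_⟩
    rw [← h3, hu]
    simp only [sub_smul, Finset.sum_sub_distrib, hk0, sub_zero]
  rintro (j | j)
  · exact (mul_eq_zero.1 (hl j)).resolve_left hf
  · exact hr j

theorem IsSigmaPair.span_eq_top (hC : IsSigmaPair C' C'') {z : ι → D.Chain F}
    (hz : ∀ j, z j ∈ D.cycles C') (hz' : ∀ j, z j ∈ D.cycles ⊤)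
    (hν : ∀ j, D.nuHat (z j) ∈ D.cycles ⊤)
    (hspan : Submodule.span F[X] (Set.range fun j => classMap C' ⟨z j, hz j⟩) = ⊤) :
    Submodule.span F[X] (Set.range (Sum.elim (fun j => classMap ⊤ ⟨z j, hz' j⟩)
      fun j => classMap ⊤ ⟨D.nuHat (z j), hν j⟩)) = ⊤ := by
  set N := Submodule.span F[X] (Set.range (Sum.elim (fun j => classMap ⊤ ⟨z j, hz' j⟩)
      fun j => classMap ⊤ ⟨D.nuHat (z j), hν j⟩)) with hN
  have hl : ∀ j, classMap ⊤ ⟨z j, hz' j⟩ ∈ N := fun j => Submodule.subset_span ⟨Sum.inl j, rfl⟩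
  have hr : ∀ j, classMap ⊤ ⟨D.nuHat (z j), hν j⟩ ∈ N :=
    fun j => Submodule.subset_span ⟨Sum.inr j, rfl⟩
  -- Equality of classes modulo torsion, unwound to chains: `ν̂` is not linear, so it is applied to
  -- chains and not to classes.
  have hgen : ∀ w ∈ D.cycles C', ∃ a : ι → F[X], ∃ f : F[X], f ≠ 0 ∧
      ∃ y, f • (w - ∑ j, a j • z j) = D.d F y := by
    intro w hw
    have : classMap C' ⟨w, hw⟩ ∈ Submodule.span F[X]
        (Set.range fun j => classMap C' ⟨z j, hz j⟩) := hspan ▸ Submodule.mem_top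
    obtain ⟨a, ha⟩ := (Submodule.mem_span_range_iff_exists_fun _).1 this
    simp only [← map_smul] at ha
    rw [← map_sum, eq_comm, ← sub_eq_zero, ← map_sub, classMap_eq_zero_iff] at ha
    obtain ⟨f, hf, y, -, h⟩ := ha
    exact ⟨a, f, hf, y, by simpa using h⟩
  have hmem : ∀ x (hx : x ∈ D.cycles ⊤) x' (hx' : x' ∈ D.cycles ⊤),
      (∃ f : F[X], f ≠ 0 ∧ ∃ y, f • (x - x') = D.d F y) →
      classMap ⊤ ⟨x', hx'⟩ ∈ N → classMap ⊤ ⟨x, hx⟩ ∈ N := by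
    rintro x hx x' hx' ⟨f, hf, y, h⟩ hN'
    have : classMap ⊤ (⟨x, hx⟩ - ⟨x', hx'⟩ : D.cycles (F := F) ⊤) = 0 :=
      classMap_eq_zero_iff.2 ⟨f, hf, y, Submodule.mem_top, h⟩
    rw [map_sub, sub_eq_zero] at this
    rwa [this]
  have hsum : ∀ (a b : ι → F[X]) (h : ∑ j, a j • z j + ∑ j, b j • D.nuHat (z j) ∈ D.cycles ⊤),
      classMap ⊤ ⟨_, h⟩ ∈ N := by
    intro a b h
    have : (⟨_, h⟩ : D.cycles (F := F) ⊤) =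
        ∑ j, a j • ⟨z j, hz' j⟩ + ∑ j, b j • ⟨D.nuHat (z j), hν j⟩ := by
      apply Subtype.ext
      simp
    rw [this, map_add, map_sum, map_sum]
    simp only [map_smul]
    exact add_mem (sum_mem fun j _ => N.smul_mem _ (hl j))
      (sum_mem fun j _ => N.smul_mem _ (hr j))
  have hzsum : ∀ a b : ι → F[X],
      ∑ j, a j • z j + ∑ j, b j • D.nuHat (z j) ∈ D.cycles ⊤ := fun a b =>
    add_mem (sum_mem fun j _ => Submodule.smul_mem _ _ (hz' j))
      (sum_mem fun j _ => Submodule.smul_mem _ _ (hν j))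
  rw [eq_top_iff]
  rintro ξ -
  obtain ⟨⟨x, hx⟩, rfl⟩ := classMap_surjective ⊤ ξ
  obtain ⟨w, hw, u, hu, rfl⟩ := hC.exists_cycles_nuHat_add (mem_cycles_top.1 hx)
  have hu' : u ∈ D.cycles ⊤ := mem_cycles_top.2 hu.2
  have hw' := nuHat_mem_cycles hw.2
  have hmem_u : classMap ⊤ ⟨u, hu'⟩ ∈ N := by
    obtain ⟨a, hf⟩ := hgen u hu
    refine hmem u hu' _ (hzsum a 0) ?_ (hsum a 0 _)
    simpa using hf
  have hmem_w : classMap ⊤ ⟨D.nuHat w, hw'⟩ ∈ N := by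
    obtain ⟨a, f, hf, y, h⟩ := hgen w hw
    choose k hk using fun j => exists_nuHat_smul (D := D) (a j)
    -- By the twisted Leibniz rule, `ν̂ (∑ a j • z j)` has coefficients `a j (-h)` on the `ν̂ (z j)`
    -- and `k j` on the `z j`.
    refine hmem _ hw' _ (hzsum k fun j => (a j).comp (-X)) ?_ (hsum _ _ _)
    convert exists_smul_nuHat_eq hf h using 6
    rw [nuHat_sub, nuHat_sum]
    simp only [hk, Finset.sum_add_distrib]
    rw [add_comm]
  have := add_mem hmem_w hmem_u
  rwa [← map_add] at this

theorem numComponents_pos (p : D.Point) : 0 < D.numComponents := by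
  unfold numComponents
  have : Nonempty ((Quot fun x y : D.HalfEdge => y = D.glue x ∨ y = (x.1, x.2 + 2)) ⊕ Fin D.k) :=
    ⟨Sum.map (Quot.mk _) id p⟩
  exact Nat.card_pos

end Shumakovitch

end LinkDiagram

end Khovanov

/-! ### The proposition -/

theorem mainTheorem7 (F : Type*) [Field F] (D : Khovanov.LinkDiagram) (p : D.Point)
    (ℓ : ℕ) (hℓ : D.numComponents = ℓ)
    (Cred : Submodule (Polynomial F) (D.Chain F))
    (hCred : Cred = D.chainX F p ∨ Cred = D.chainY F p)
    (hrank : ∀ i : ℤ, Module.finrank (Polynomial F) (D.HomologyAt Cred i) ≤ 1)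
    (z : Fin (2 ^ (ℓ - 1)) → D.Chain F)
    (hz : ∀ j, z j ∈ D.cycles Cred)
    (hbasis : ∃ b : Module.Basis (Fin (2 ^ (ℓ - 1))) (Polynomial F) (D.HomologyModTor Cred),
      ∀ j, b j = D.homologyClass Cred (z j) (hz j)) :
    (∃ (hz' : ∀ j, z j ∈ D.cycles (⊤ : Submodule (Polynomial F) (D.Chain F)))
        (hν : ∀ j, D.nuHat (z j) ∈ D.cycles (⊤ : Submodule (Polynomial F) (D.Chain F)))
        (b : Module.Basis (Fin (2 ^ (ℓ - 1)) ⊕ Fin (2 ^ (ℓ - 1))) (Polynomial F)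
          (D.HomologyModTor (⊤ : Submodule (Polynomial F) (D.Chain F)))),
        (∀ j, b (Sum.inl j) = D.homologyClass ⊤ (z j) (hz' j)) ∧
        (∀ j, b (Sum.inr j) = D.homologyClass ⊤ (D.nuHat (z j)) (hν j))) ∧
    Nonempty (D.HomologyModTor (⊤ : Submodule (Polynomial F) (D.Chain F)) ≃ₗ[Polynomial F]
      (Fin (2 ^ ℓ) → Polynomial F)) := by
  obtain ⟨C'', hC⟩ : ∃ C'', Khovanov.LinkDiagram.IsSigmaPair Cred C'' := by
    rcases hCred with rfl | rfl
    · exact ⟨_, Khovanov.LinkDiagram.isSigmaPair_chainX_chainY p⟩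
    · exact ⟨_, Khovanov.LinkDiagram.isSigmaPair_chainY_chainX p⟩
  obtain ⟨b, hb⟩ := hbasis
  have hb' : (fun j => Khovanov.LinkDiagram.classMap Cred ⟨z j, hz j⟩) = b :=
    funext fun j => (hb j).symm
  have hz' : ∀ j, z j ∈ D.cycles ⊤ := fun j => Khovanov.LinkDiagram.mem_cycles_top.2 (hz j).2
  have hν : ∀ j, D.nuHat (z j) ∈ D.cycles ⊤ :=
    fun j => Khovanov.LinkDiagram.nuHat_mem_cycles (hz j).2
  have hli := hC.linearIndependent hz hz' hν (hb' ▸ b.linearIndependent)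
  have hspan := hC.span_eq_top hz hz' hν (hb' ▸ b.span_eq)
  let B := Module.Basis.mk hli hspan.ge
  -- The truncated subtraction is harmless: the base point lies on some component, so `ℓ ≥ 1`.
  have hcard : 2 ^ (ℓ - 1) + 2 ^ (ℓ - 1) = 2 ^ ℓ := by
    have hpos := Khovanov.LinkDiagram.numComponents_pos p
    rw [hℓ] at hpos
    rw [← two_mul, ← pow_succ', Nat.sub_add_cancel hpos]
  exact ⟨⟨hz', hν, B, fun j => Module.Basis.mk_apply hli hspan.ge _,
    fun j => Module.Basis.mk_apply hli hspan.ge _⟩,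
    ⟨(B.reindex (finSumFinEquiv.trans (finCongr hcard))).equivFun⟩⟩
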